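/- Let $\mathcal Z$ be a Polish space (for instance $\mathbb R^m$ with its usual topology) with its Borel $\sigma$-algebra, let $d:\mathcal Z\times\mathcal Z\to[0,\infty)$ be a metric on $\mathcal Z$ that is continuous for this topology (for instance a metric that induces it), let $1\le p<\infty$, and let $0\in\mathcal Z$ be a fixed reference point. For Borel probability measures $\rho,\rho'$ on $\mathcal Z$ let $$W_p(\rho,\rho')=\Bigl(\inf_{X\sim\rho,\;X'\sim\rho'}\mathbb E\bigl[d^p(X,X')\bigr]\Bigr)^{1/p},$$ the infimum being over all couplings of $\rho$ and $\rho'$. Let $(q_\sigma)_{0\le\sigma<\infty}$ be probability mass functions on $\mathbb Z$ such that 1. $q_\sigma(k)=q_\sigma(-k)$ for all $\sigma$ and $k$; 2. $q_\sigma(k)\ge q_\sigma(k')$ for all $\sigma$ and all $k,k'\in\mathbb Z$ with $|k|\le|k'|$; 3. $\lim_{\sigma\to\infty}q_\sigma(k)=0$ for all $k$. Let $(z_n)_{n\in\mathbb Z}$ and $(\hat z_n)_{n\in\mathbb Z}$ be two sequences in $\mathcal Z$ (the feature sequences of the source and of the reconstruction), and let $$D_{0,\sigma}=W_p^p\Bigl(\sum_{k\in\mathbb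 Z}q_\sigma(k)\,\delta_{z_k},\ \sum_{k\in\mathbb Z}q_\sigma(k)\,\delta_{\hat z_k}\Bigr)$$ be the Wasserstein distortion at time $0$ with pooling width $\sigma$. Let $F_N$ and $\hat F_N$ be the empirical distributions of $z_{-N},\dots,z_N$ and of $\hat z_{-N},\dots,\hat z_N$, and let $F$ and $\hat F$ be Borel probability measures on $\mathcal Z$. Suppose that, as $N\to\infty$, $F_N\to F$ and $\hat F_N\to\hat F$ weakly, and $$\int d^p(z,0)\,dF_N\to\int d^p(z,0)\,dF<\infty,\qquad \int d^p(z,0)\,d\hat F_N\to\int d^p(z,0)\,d\hat F<\infty,$$ and that, for all $\sigma\ge 0$, $$\sum_{k\in\mathbb Z}q_\sigma(k)\,d^p(z_k,0)<\infty\quad\text{and}\quad\sum_{k\in\mathbb Z}q_\sigma(k)\,d^p(\hat z_k,0)<\infty.$$ Then $D_{0,\sigma}$ (for every $\sigma\ge 0$) and $W_p(F,\hat F)$ are finite, and $$\lim_{\sigma\to\infty}D_{0,\sigma}=W_p^p(F,\hat F).$$ -/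

import Mathlib

open scoped NNReal ENNReal Topology
open MeasureTheory Filter

/-- The cost function `d` is a metric on the set `Z`. -/
structure IsMetricOn {Z : Type*} (d : Z → Z → ℝ) : Prop where
  nonneg : ∀ x y, 0 ≤ d x y
  eq_zero_iff : ∀ x y, d x y = 0 ↔ x = y
  symm : ∀ x y, d x y = d y x
  triangle : ∀ x y w, d x w ≤ d x y + d y w

/-- `π` is a coupling of `μ` and `ν`: a measure on the product with these marginals. -/
structure IsCoupling {Z : Type*} [MeasurableSpace Z] (π : Measure (Z × Z)) (μ ν : Measure Z) :
    Prop where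
  fst : π.map Prod.fst = μ
  snd : π.map Prod.snd = ν

/-- The `p`-Wasserstein distance induced by the cost function `d`:
`(inf E[d(X, Y)^p])^(1/p)`, the infimum being over all couplings of `μ` and `ν`. -/
noncomputable def wassersteinDist {Z : Type*} [MeasurableSpace Z] (d : Z → Z → ℝ) (p : ℝ)
    (μ ν : Measure Z) : ℝ≥0∞ :=
  (⨅ (π : Measure (Z × Z)) (_ : IsCoupling π μ ν),
    ∫⁻ w, ENNReal.ofReal (d w.1 w.2 ^ p) ∂π) ^ (1 / p)

/-- The pooled measure at time `n`: `∑ k, q(k) δ_{z (n + k)}`. -/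
noncomputable def pooledMeasure {Z : Type*} [MeasurableSpace Z] (q : PMF ℤ) (z : ℤ → Z) (n : ℤ) :
    Measure Z :=
  Measure.sum fun k : ℤ => q k • Measure.dirac (z (n + k))

/-- The distortion at time `n`: the `p`-th power of the `p`-Wasserstein distance between the
measures pooled with `q` from the feature sequences `z` and `z'`. -/
noncomputable def distortionAt {Z : Type*} [MeasurableSpace Z] (d : Z → Z → ℝ) (p : ℝ)
    (q : PMF ℤ) (z z' : ℤ → Z) (n : ℤ) : ℝ≥0∞ :=
  wassersteinDist d p (pooledMeasure q z n) (pooledMeasure q z' n) ^ p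

/-- The empirical distribution of `z (-N), …, z N`. -/
noncomputable def empiricalDist {Z : Type*} [MeasurableSpace Z] (z : ℤ → Z) (N : ℕ) :
    ProbabilityMeasure Z :=
  ⟨((2 * N + 1 : ℕ) : ℝ≥0∞)⁻¹ • ∑ k ∈ Finset.Icc (-(N : ℤ)) N, Measure.dirac (z k), ⟨by
    have h : (Finset.Icc (-(N : ℤ)) N).card = 2 * N + 1 := by
      rw [Int.card_Icc]; omega
    rw [Measure.smul_apply, Measure.finsetSum_apply]
    simp only [measure_univ, Finset.sum_const, h, nsmul_eq_mul, mul_one, smul_eq_mul]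
    exact ENNReal.inv_mul_cancel (by simp) (ENNReal.natCast_ne_top _)⟩⟩

/-!
A symmetric probability mass function on `ℤ` that decreases in `|k|` is a mixture of the uniform
distributions on the windows `[-N, N]`, with weights `(2 N + 1) (q N - q (N + 1))`. When `q σ`
spreads out, each weight tends to `0`, so by Toeplitz's lemma the pooled averages of any sequence
have the same limit as its window averages (`tendsto_tsum_mul_of_tendsto_average`). Applied to
bounded continuous functions and to `d(·, z₀) ^ p`, this shows that the pooled measures converge
weakly to `F` and `F'`, with their `p`-th moments.

Such convergence, of measures `μ` to `ν` say, implies convergence in the Wasserstein distance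
(`tendsto_transportCost_zero`).
The proof couples the measures locally: for a continuous partition of unity `φ` with supports of
small `d`-diameter, the parts `φ j • μ` and `φ j • ν`, scaled to equal mass, are coupled by
normalized products at small cost. What remains of the two measures is coupled by a product too, at
a cost bounded by its moments, and these tend to the moment of `ν` outside the first `k`
functions `φ j` (`transportCost_le_of_partition`). Only integrals of bounded continuous functions and the full
moments enter, so neither continuity sets nor tightness are needed.

Finally, the triangle inequality for the Wasserstein distance, from gluing of couplings and
Minkowski's inequality (`wassersteinDist_triangle`), turns the convergence of the two families of
pooled measures into the convergence of their mutual distance (`tendsto_wassersteinDist`).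
-/

/-! ### Averages against symmetric decreasing weights -/

theorem tsum_ite_sub_succ {u : ℕ → ℝ≥0∞} (hu : Antitone u) (hu0 : Tendsto u atTop (𝓝 0))
    (n : ℕ) : ∑' N : ℕ, (if n ≤ N then u N - u (N + 1) else 0) = u n := by
  have key : ∀ M, ∑ N ∈ Finset.range M, (if n ≤ N then u N - u (N + 1) else 0) =
      u n - u (max n M) := by
    intro M
    induction M with
    | zero => simp
    | succ M ih =>
      rw [Finset.sum_range_succ, ih]
      split_ifs with h
      · rw [max_eq_right h, max_eq_right (by omega)]
        exact tsub_add_tsub_cancel (hu h) (hu (Nat.le_succ M))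
      · rw [max_eq_left (by omega), max_eq_left (by omega), add_zero]
  refine tendsto_nhds_unique (ENNReal.tendsto_nat_tsum _) ?_
  simp only [key]
  have hmax : Tendsto (fun M => max n M) atTop atTop :=
    tendsto_atTop_mono (fun M => le_max_right n M) tendsto_id
  simpa using ENNReal.Tendsto.sub (tendsto_const_nhds (x := u n)) (hu0.comp hmax)
    (Or.inr ENNReal.zero_ne_top)

/-- Summation by parts: a sum weighted by a summable `q` that decreases in `|k|` (in particular is
symmetric) is a nonnegative combination of the sums over the windows `[-N, N]`. -/
theorem tsum_mul_eq_tsum_sub_succ_mul_sum {q : ℤ → ℝ≥0∞}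
    (hmono : ∀ k k' : ℤ, |k| ≤ |k'| → q k' ≤ q k) (hq : ∑' k, q k ≠ ∞) (a : ℤ → ℝ≥0∞) :
    ∑' k, q k * a k =
      ∑' N : ℕ, (q N - q ((N + 1 : ℕ) : ℤ)) * ∑ k ∈ Finset.Icc (-(N : ℤ)) N, a k := by
  have hu : Antitone fun n : ℕ => q n := fun m n h => hmono _ _ (by simpa using h)
  have hu0 : Tendsto (fun n : ℕ => q n) atTop (𝓝 0) := by
    refine ENNReal.tendsto_atTop_zero_of_tsum_ne_top (ne_top_of_le_ne_top hq ?_)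
    exact ENNReal.tsum_comp_le_tsum_of_injective Nat.cast_injective q
  have hqk : ∀ k : ℤ, q k =
      ∑' N : ℕ, (if k.natAbs ≤ N then q N - q ((N + 1 : ℕ) : ℤ) else 0) := by
    intro k
    rw [tsum_ite_sub_succ hu hu0]
    exact le_antisymm (hmono _ _ (by simp)) (hmono _ _ (by simp))
  calc ∑' k, q k * a k
      = ∑' k : ℤ, ∑' N : ℕ,
          (if k.natAbs ≤ N then q N - q ((N + 1 : ℕ) : ℤ) else 0) * a k := by
        refine tsum_congr fun k => ?_
        rw [ENNReal.tsum_mul_right, ← hqk]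
    _ = ∑' N : ℕ, ∑' k : ℤ,
          (if k.natAbs ≤ N then q N - q ((N + 1 : ℕ) : ℤ) else 0) * a k := ENNReal.tsum_comm
    _ = _ := by
        refine tsum_congr fun N => ?_
        rw [Finset.mul_sum, tsum_eq_sum (s := Finset.Icc (-(N : ℤ)) N)]
        · refine Finset.sum_congr rfl fun k hk => ?_
          rw [Finset.mem_Icc] at hk
          rw [if_pos (by omega)]
        · intro k hk
          rw [Finset.mem_Icc] at hk
          rw [if_neg (by omega), zero_mul]

theorem tsum_ite_mem_finset {α : Type*} [DecidableEq α] (s : Finset α) (f : α → ℝ≥0∞) :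
    ∑' a, (if a ∈ s then f a else 0) = ∑ a ∈ s, f a :=
  (tsum_eq_sum fun _ ha => if_neg ha).trans (Finset.sum_congr rfl fun _ ha => if_pos ha)

/-- Toeplitz's lemma in `ℝ≥0∞`: averages of a convergent sequence of finite terms converge to its
limit if the weights sum to `1` and each of them vanishes in the limit. -/
theorem tendsto_tsum_mul_of_tendsto {ι : Type*} {l : Filter ι} {w : ι → ℕ → ℝ≥0∞}
    (hw : ∀ i, ∑' N, w i N = 1) (hw0 : ∀ N, Tendsto (fun i => w i N) l (𝓝 0))
    {A : ℕ → ℝ≥0∞} {a : ℝ≥0∞} (hA : ∀ N, A N ≠ ∞) (hAa : Tendsto A atTop (𝓝 a)) :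
    Tendsto (fun i => ∑' N, w i N * A N) l (𝓝 a) := by
  refine tendsto_order.2 ⟨fun b hb => ?_, fun b hb => ?_⟩
  · obtain ⟨c, hbc, hca⟩ := exists_between hb
    obtain ⟨N₀, hN₀⟩ := eventually_atTop.1 (hAa.eventually (lt_mem_nhds hca))
    have hhead : Tendsto (fun i => ∑ N ∈ Finset.range N₀, w i N * c) l (𝓝 0) := by
      have := tendsto_finsetSum (Finset.range N₀) fun N _ =>
        ENNReal.Tendsto.mul_const (b := c) (hw0 N) (Or.inr hca.ne_top)
      simpa using this
    filter_upwards [hhead.eventually (gt_mem_nhds (tsub_pos_of_lt hbc))] with i hi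
    have hle : c ≤ ∑' N, w i N * A N + ∑ N ∈ Finset.range N₀, w i N * c := by
      calc c = ∑' N, w i N * c := by rw [ENNReal.tsum_mul_right, hw, one_mul]
        _ ≤ ∑' N, (w i N * A N + if N ∈ Finset.range N₀ then w i N * c else 0) := by
            refine ENNReal.tsum_le_tsum fun N => ?_
            by_cases hN : N ∈ Finset.range N₀
            · simp [hN]
            · simp only [hN, if_false, add_zero]
              gcongr
              exact (hN₀ N (by simpa using hN)).le
        _ = _ := by
            rw [ENNReal.tsum_add, tsum_ite_mem_finset]
    by_contra! hS
    refine absurd hle (not_le.2 ?_)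
    calc _ < b + (c - b) :=
          ENNReal.add_lt_add_of_le_of_lt (ne_top_of_le_ne_top (ne_top_of_lt hbc) hS) hS hi
      _ = c := add_tsub_cancel_of_le hbc.le
  · obtain ⟨c, hac, hcb⟩ := exists_between hb
    obtain ⟨N₀, hN₀⟩ := eventually_atTop.1 (hAa.eventually (gt_mem_nhds hac))
    have hhead : Tendsto (fun i => (∑ N ∈ Finset.range N₀, w i N * A N) + c) l (𝓝 c) := by
      have := (tendsto_finsetSum (Finset.range N₀) fun N _ =>
        ENNReal.Tendsto.mul_const (b := A N) (hw0 N) (Or.inr (hA N))).add_const c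
      simpa using this
    filter_upwards [hhead.eventually (gt_mem_nhds hcb)] with i hi
    refine lt_of_le_of_lt ?_ hi
    calc ∑' N, w i N * A N
        ≤ ∑' N, ((if N ∈ Finset.range N₀ then w i N * A N else 0) + w i N * c) := by
            refine ENNReal.tsum_le_tsum fun N => ?_
            by_cases hN : N ∈ Finset.range N₀
            · simp [hN]
            · simp only [hN, if_false, zero_add]
              gcongr
              exact (hN₀ N (by simpa using hN)).le
      _ = _ := by
            rw [ENNReal.tsum_add, ENNReal.tsum_mul_right, hw, one_mul, tsum_ite_mem_finset]

/-- Since symmetric decreasing probability mass functions are mixtures of uniform distributions on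
windows `[-N, N]`, averages against them inherit the limit of the window averages as the mass
spreads out. -/
theorem tendsto_tsum_mul_of_tendsto_average {ι : Type*} {l : Filter ι} (q : ι → PMF ℤ)
    (hmono : ∀ i (k k' : ℤ), |k| ≤ |k'| → q i k' ≤ q i k)
    (hunif : ∀ k, Tendsto (fun i => q i k) l (𝓝 0)) {a : ℤ → ℝ≥0∞} (ha : ∀ k, a k ≠ ∞)
    {m : ℝ≥0∞}
    (hm : Tendsto (fun N : ℕ =>
      ((2 * N + 1 : ℕ) : ℝ≥0∞)⁻¹ * ∑ k ∈ Finset.Icc (-(N : ℤ)) N, a k) atTop (𝓝 m)) :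
    Tendsto (fun i => ∑' k, q i k * a k) l (𝓝 m) := by
  have hne : ∀ N : ℕ, ((2 * N + 1 : ℕ) : ℝ≥0∞) ≠ 0 := fun N => by simp
  have habel := fun i => tsum_mul_eq_tsum_sub_succ_mul_sum (hmono i)
    (by rw [PMF.tsum_coe]; exact ENNReal.one_ne_top)
  -- The weights sum to `1` by the summation by parts applied to the constant sequence `1`.
  have hw1 : ∀ i, ∑' N : ℕ, (q i N - q i ((N + 1 : ℕ) : ℤ)) * ((2 * N + 1 : ℕ) : ℝ≥0∞) = 1 := by
    intro i
    have h := habel i fun _ => 1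
    simp only [mul_one, PMF.tsum_coe] at h
    rw [h]
    refine tsum_congr fun N => ?_
    have hcard : (Finset.Icc (-(N : ℤ)) N).card = 2 * N + 1 := by rw [Int.card_Icc]; omega
    rw [Finset.sum_const, hcard, nsmul_eq_mul, mul_one]
  have hw0 : ∀ N : ℕ, Tendsto
      (fun i => (q i N - q i ((N + 1 : ℕ) : ℤ)) * ((2 * N + 1 : ℕ) : ℝ≥0∞)) l (𝓝 0) := by
    intro N
    have h := ENNReal.Tendsto.mul_const (b := ((2 * N + 1 : ℕ) : ℝ≥0∞)) (hunif N)
      (Or.inr (ENNReal.natCast_ne_top _))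
    rw [zero_mul] at h
    exact tendsto_of_tendsto_of_tendsto_of_le_of_le tendsto_const_nhds h (fun _ => zero_le)
      fun i => by dsimp only; gcongr; exact tsub_le_self
  have hA : ∀ N : ℕ, ((2 * N + 1 : ℕ) : ℝ≥0∞)⁻¹ * ∑ k ∈ Finset.Icc (-(N : ℤ)) N, a k ≠ ∞ :=
    fun N => ENNReal.mul_ne_top (ENNReal.inv_ne_top.2 (hne N))
      (ENNReal.sum_ne_top.2 fun k _ => ha k)
  refine (tendsto_tsum_mul_of_tendsto hw1 hw0 hA hm).congr fun i => ?_
  rw [habel]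
  refine tsum_congr fun N => ?_
  rw [mul_assoc, ← mul_assoc ((2 * N + 1 : ℕ) : ℝ≥0∞),
    ENNReal.mul_inv_cancel (hne N) (ENNReal.natCast_ne_top _), one_mul]

/-! ### Integrals against pooled measures -/

section Pooling

variable {Z : Type*} [MeasurableSpace Z]

theorem lintegral_pooledMeasure_zero (q : PMF ℤ) (z : ℤ → Z) {f : Z → ℝ≥0∞}
    (hf : Measurable f) : ∫⁻ x, f x ∂pooledMeasure q z 0 = ∑' k, q k * f (z k) := by
  simp [pooledMeasure, lintegral_sum_measure, lintegral_smul_measure, lintegral_dirac' _ hf]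

theorem isProbabilityMeasure_pooledMeasure (q : PMF ℤ) (z : ℤ → Z) (n : ℤ) :
    IsProbabilityMeasure (pooledMeasure q z n) := by
  constructor
  simp [pooledMeasure, Measure.sum_apply, PMF.tsum_coe]

theorem lintegral_empiricalDist (z : ℤ → Z) (N : ℕ) {f : Z → ℝ≥0∞} (hf : Measurable f) :
    ∫⁻ x, f x ∂(empiricalDist z N : Measure Z) =
      ((2 * N + 1 : ℕ) : ℝ≥0∞)⁻¹ * ∑ k ∈ Finset.Icc (-(N : ℤ)) N, f (z k) := by
  change ∫⁻ x, f x ∂(((2 * N + 1 : ℕ) : ℝ≥0∞)⁻¹ •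
    ∑ k ∈ Finset.Icc (-(N : ℤ)) N, Measure.dirac (z k)) = _
  rw [lintegral_smul_measure, lintegral_finsetSum_measure]
  simp [lintegral_dirac' _ hf]

theorem tendsto_lintegral_pooledMeasure {ι : Type*} {l : Filter ι} (q : ι → PMF ℤ)
    (hmono : ∀ i (k k' : ℤ), |k| ≤ |k'| → q i k' ≤ q i k)
    (hunif : ∀ k, Tendsto (fun i => q i k) l (𝓝 0)) (z : ℤ → Z) {f : Z → ℝ≥0∞}
    (hf : Measurable f) (hfin : ∀ x, f x ≠ ∞) {m : ℝ≥0∞}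
    (hm : Tendsto (fun N => ∫⁻ x, f x ∂(empiricalDist z N : Measure Z)) atTop (𝓝 m)) :
    Tendsto (fun i => ∫⁻ x, f x ∂pooledMeasure (q i) z 0) l (𝓝 m) := by
  simp only [lintegral_empiricalDist z _ hf] at hm
  simp only [lintegral_pooledMeasure_zero _ z hf]
  exact tendsto_tsum_mul_of_tendsto_average q hmono hunif (fun k => hfin _) hm

end Pooling

/-! ### Couplings and transport cost -/

/-- The `p`-th power of the Wasserstein distance, before the root is taken: the infimum of
`E[d(X, Y)^p]` over couplings. It is used for arbitrary measures, and is `∞` when the masses differ,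
as there is no coupling then. -/
noncomputable def transportCost {Z : Type*} [MeasurableSpace Z] (d : Z → Z → ℝ) (p : ℝ)
    (μ ν : Measure Z) : ℝ≥0∞ :=
  ⨅ (π : Measure (Z × Z)) (_ : IsCoupling π μ ν), ∫⁻ w, ENNReal.ofReal (d w.1 w.2 ^ p) ∂π

theorem ofReal_rpow_le {Z : Type*} {d : Z → Z → ℝ} {p : ℝ} (hd : IsMetricOn d) (hp : 1 ≤ p)
    (x y a : Z) :
    ENNReal.ofReal (d x y ^ p) ≤
      2 ^ (p - 1) * (ENNReal.ofReal (d x a ^ p) + ENNReal.ofReal (d y a ^ p)) := by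
  have hp0 : 0 ≤ p := by linarith
  rw [← ENNReal.ofReal_rpow_of_nonneg (hd.nonneg _ _) hp0,
    ← ENNReal.ofReal_rpow_of_nonneg (hd.nonneg _ _) hp0,
    ← ENNReal.ofReal_rpow_of_nonneg (hd.nonneg _ _) hp0]
  refine le_trans ?_ (ENNReal.rpow_add_le_mul_rpow_add_rpow _ _ hp)
  gcongr
  rw [← ENNReal.ofReal_add (hd.nonneg _ _) (hd.nonneg _ _)]
  exact ENNReal.ofReal_le_ofReal (hd.symm y a ▸ hd.triangle x a y)

section Couplings

variable {Z : Type*} [MeasurableSpace Z] {d : Z → Z → ℝ} {p : ℝ}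

theorem IsCoupling.lintegral_fst {π : Measure (Z × Z)} {μ ν : Measure Z} (h : IsCoupling π μ ν)
    {f : Z → ℝ≥0∞} (hf : Measurable f) : ∫⁻ w, f w.1 ∂π = ∫⁻ x, f x ∂μ := by
  rw [← h.fst, lintegral_map hf measurable_fst]

theorem IsCoupling.lintegral_snd {π : Measure (Z × Z)} {μ ν : Measure Z} (h : IsCoupling π μ ν)
    {f : Z → ℝ≥0∞} (hf : Measurable f) : ∫⁻ w, f w.2 ∂π = ∫⁻ x, f x ∂ν := by
  rw [← h.snd, lintegral_map hf measurable_snd]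

/-- The normalized product is a coupling of any two finite measures of the same mass. For mass zero
both measures vanish, and so does the product, whatever the value of the inverse `0⁻¹ = ∞`. -/
theorem isCoupling_prod {μ ν : Measure Z} [IsFiniteMeasure μ] [IsFiniteMeasure ν]
    (h : μ Set.univ = ν Set.univ) : IsCoupling ((μ Set.univ)⁻¹ • μ.prod ν) μ ν := by
  by_cases h0 : μ Set.univ = 0
  · have hμ := Measure.measure_univ_eq_zero.1 h0
    have hν := Measure.measure_univ_eq_zero.1 (h ▸ h0)
    subst hμ hν
    exact ⟨by simp, by simp⟩
  · have hinv : (μ Set.univ)⁻¹ * μ Set.univ = 1 :=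
      ENNReal.inv_mul_cancel h0 (measure_ne_top _ _)
    constructor
    · rw [Measure.map_smul, Measure.map_fst_prod, ← h, smul_smul, hinv, one_smul]
    · rw [Measure.map_smul, Measure.map_snd_prod, smul_smul, hinv, one_smul]

theorem IsCoupling.add {π π' : Measure (Z × Z)} {μ ν μ' ν' : Measure Z} (h : IsCoupling π μ ν)
    (h' : IsCoupling π' μ' ν') : IsCoupling (π + π') (μ + μ') (ν + ν') :=
  ⟨by rw [Measure.map_add _ _ measurable_fst, h.fst, h'.fst],
    by rw [Measure.map_add _ _ measurable_snd, h.snd, h'.snd]⟩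

theorem transportCost_le {π : Measure (Z × Z)} {μ ν : Measure Z} (h : IsCoupling π μ ν) :
    transportCost d p μ ν ≤ ∫⁻ w, ENNReal.ofReal (d w.1 w.2 ^ p) ∂π :=
  iInf₂_le π h

theorem transportCost_add_le (μ ν μ' ν' : Measure Z) :
    transportCost d p (μ + μ') (ν + ν') ≤ transportCost d p μ ν + transportCost d p μ' ν' := by
  simp only [transportCost, ENNReal.iInf_add, ENNReal.add_iInf]
  refine le_iInf₂ fun π' hπ' => le_iInf₂ fun π hπ => ?_
  rw [← lintegral_add_measure]
  exact iInf₂_le (π + π') (hπ.add hπ')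

theorem transportCost_sum_le {ι : Type*} (s : Finset ι) (μ ν : ι → Measure Z) :
    transportCost d p (∑ i ∈ s, μ i) (∑ i ∈ s, ν i) ≤ ∑ i ∈ s, transportCost d p (μ i) (ν i) := by
  classical
  induction s using Finset.induction_on with
  | empty =>
    simpa using transportCost_le (d := d) (p := p) (π := 0) (μ := 0) (ν := (0 : Measure Z))
      ⟨by simp, by simp⟩
  | insert i s hi ih =>
    simp only [Finset.sum_insert hi]
    exact (transportCost_add_le _ _ _ _).trans (by gcongr)

theorem transportCost_comm (hd : IsMetricOn d) (hm : Measurable fun w : Z × Z => d w.1 w.2)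
    (μ ν : Measure Z) : transportCost d p μ ν = transportCost d p ν μ := by
  suffices H : ∀ μ ν : Measure Z, transportCost d p μ ν ≤ transportCost d p ν μ from
    le_antisymm (H _ _) (H _ _)
  intro μ ν
  refine le_iInf₂ fun π hπ => ?_
  have hswap : IsCoupling (π.map Prod.swap) μ ν :=
    ⟨by rw [Measure.map_map measurable_fst measurable_swap]; exact hπ.snd,
      by rw [Measure.map_map measurable_snd measurable_swap]; exact hπ.fst⟩
  refine (transportCost_le hswap).trans_eq ?_
  rw [lintegral_map (by fun_prop) measurable_swap]
  exact lintegral_congr fun w => by rw [Prod.fst_swap, Prod.snd_swap, hd.symm]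

/-- The normalized product coupling bounds the cost by moments about an arbitrary point `a`. For `a`
close to both supports the bound is small; for a fixed `a` it is small when both moments are. -/
theorem transportCost_le_of_measure_univ_eq (hd : IsMetricOn d)
    (hm : Measurable fun w : Z × Z => d w.1 w.2) (hp : 1 ≤ p) {μ ν : Measure Z}
    [IsFiniteMeasure μ] [IsFiniteMeasure ν] (h : μ Set.univ = ν Set.univ) (a : Z) :
    transportCost d p μ ν ≤ 2 ^ (p - 1) *
      (∫⁻ x, ENNReal.ofReal (d x a ^ p) ∂μ + ∫⁻ x, ENNReal.ofReal (d x a ^ p) ∂ν) := by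
  have hma : Measurable fun x => ENNReal.ofReal (d x a ^ p) := by
    have : Measurable fun x => d x a := hm.comp measurable_prodMk_right
    fun_prop
  have hπ := isCoupling_prod h
  refine (transportCost_le hπ).trans ?_
  refine (lintegral_mono fun w : Z × Z => ofReal_rpow_le hd hp w.1 w.2 a).trans_eq ?_
  rw [lintegral_const_mul _ (by fun_prop), lintegral_add_left (by fun_prop),
    hπ.lintegral_fst hma, hπ.lintegral_snd hma]

end Couplings

/-! ### Localizing the transport cost -/

theorem withDensity_finsetSum {Z ι : Type*} [MeasurableSpace Z] (μ : Measure Z) (s : Finset ι)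
    {f : ι → Z → ℝ≥0∞} (hf : ∀ i, Measurable (f i)) :
    μ.withDensity (∑ i ∈ s, f i) = ∑ i ∈ s, μ.withDensity (f i) := by
  classical
  induction s using Finset.induction_on with
  | empty => simp
  | insert i s hi ih =>
    rw [Finset.sum_insert hi, Finset.sum_insert hi, withDensity_add_left (hf i), ih]

section Localization

variable {Z : Type*} [MeasurableSpace Z] {d : Z → Z → ℝ} {p : ℝ}

theorem eq_withDensity_sub_add_sum (μ : Measure Z) (k : ℕ) {f : ℕ → Z → ℝ≥0∞}
    (hf : ∀ j, Measurable (f j)) (hf1 : ∀ x, ∑ j ∈ Finset.range k, f j x ≤ 1) :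
    μ = μ.withDensity (fun x => 1 - ∑ j ∈ Finset.range k, f j x) +
      ∑ j ∈ Finset.range k, μ.withDensity (f j) := by
  rw [← withDensity_finsetSum μ _ hf, ← withDensity_add_right _ (by fun_prop)]
  conv_lhs => rw [← withDensity_one (μ := μ)]
  congr 1
  ext x
  simpa using (tsub_add_cancel_of_le (hf1 x)).symm

/-- Transport bound from localization. Let `f j` be functions with sum at most `1`, each supported
in a `d`-ball of radius `r`. The parts `f j • μ` and `f j • ν` are scaled down to their smaller
mass and coupled with each other, at cost at most `2 ^ p * r ^ p` in total; the remainders of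
`μ` and `ν` are then of equal mass, and their moments are what the differences on the right compute. -/
theorem transportCost_le_of_partition (hd : IsMetricOn d)
    (hm : Measurable fun w : Z × Z => d w.1 w.2) (hp : 1 ≤ p) {μ ν : Measure Z}
    [IsProbabilityMeasure μ] [IsProbabilityMeasure ν] (a : Z)
    (hμ : ∫⁻ x, ENNReal.ofReal (d x a ^ p) ∂μ ≠ ∞) (hν : ∫⁻ x, ENNReal.ofReal (d x a ^ p) ∂ν ≠ ∞)
    (k : ℕ) {f : ℕ → Z → ℝ≥0∞} (hf : ∀ j, Measurable (f j))
    (hf1 : ∀ x, ∑ j ∈ Finset.range k, f j x ≤ 1) {r : ℝ} (c : ℕ → Z)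
    (hc : ∀ j x, f j x ≠ 0 → d x (c j) ≤ r) :
    transportCost d p μ ν ≤ 2 ^ (p - 1) * (2 * ENNReal.ofReal (r ^ p) +
      (∫⁻ x, ENNReal.ofReal (d x a ^ p) ∂μ - ∑ j ∈ Finset.range k,
        min (∫⁻ x, f j x ∂μ) (∫⁻ x, f j x ∂ν) / (∫⁻ x, f j x ∂μ) *
          ∫⁻ x, f j x * ENNReal.ofReal (d x a ^ p) ∂μ) +
      (∫⁻ x, ENNReal.ofReal (d x a ^ p) ∂ν - ∑ j ∈ Finset.range k,
        min (∫⁻ x, f j x ∂μ) (∫⁻ x, f j x ∂ν) / (∫⁻ x, f j x ∂ν) *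
          ∫⁻ x, f j x * ENNReal.ofReal (d x a ^ p) ∂ν)) := by
  have hmc : ∀ b, Measurable fun x => ENNReal.ofReal (d x b ^ p) := fun b => by
    have : Measurable fun x => d x b := hm.comp measurable_prodMk_right
    fun_prop
  set m : ℕ → ℝ≥0∞ := fun j => min (∫⁻ x, f j x ∂μ) (∫⁻ x, f j x ∂ν)
  -- Each of the two measures splits into local parts of mass `m j` and a remainder.
  have side : ∀ ρ : Measure Z, IsProbabilityMeasure ρ →
      (∫⁻ x, ENNReal.ofReal (d x a ^ p) ∂ρ ≠ ∞) → (∀ j, m j ≤ ∫⁻ x, f j x ∂ρ) →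
      ∃ (res : Measure Z) (part : ℕ → Measure Z), ρ = res + ∑ j ∈ Finset.range k, part j ∧
        IsFiniteMeasure res ∧ (∀ j ∈ Finset.range k, part j Set.univ = m j) ∧
        (∀ j ∈ Finset.range k, ∫⁻ x, ENNReal.ofReal (d x (c j) ^ p) ∂part j ≤
          ENNReal.ofReal (r ^ p) * m j) ∧
        ∫⁻ x, ENNReal.ofReal (d x a ^ p) ∂res = ∫⁻ x, ENNReal.ofReal (d x a ^ p) ∂ρ -
          ∑ j ∈ Finset.range k, m j / (∫⁻ x, f j x ∂ρ) *
            ∫⁻ x, f j x * ENNReal.ofReal (d x a ^ p) ∂ρ := by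
    intro ρ _ hρ hmρ
    set α : ℕ → ℝ≥0∞ := fun j => m j / ∫⁻ x, f j x ∂ρ with hα
    have hα1 : ∀ j, α j ≤ 1 := fun j => ENNReal.div_le_of_le_mul (by simpa using hmρ j)
    have hαf : ∀ j, Measurable fun x => α j * f j x := fun j => (hf j).const_mul _
    have hαf1 : ∀ x, ∑ j ∈ Finset.range k, α j * f j x ≤ 1 := fun x =>
      (Finset.sum_le_sum fun j _ => mul_le_of_le_one_left' (hα1 j)).trans (hf1 x)
    have hdec := eq_withDensity_sub_add_sum ρ k hαf hαf1
    have hle1 : ∀ j ∈ Finset.range k, ∀ x, f j x ≤ 1 := fun j hj x =>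
      (Finset.single_le_sum (f := fun j => f j x) (fun _ _ => zero_le) hj).trans (hf1 x)
    have hfin : ∀ j ∈ Finset.range k, ∫⁻ x, f j x ∂ρ ≠ ∞ := fun j hj =>
      ne_top_of_le_ne_top ENNReal.one_ne_top
        ((lintegral_mono (hle1 j hj)).trans (by simp))
    have hmass : ∀ j ∈ Finset.range k, ρ.withDensity (fun x => α j * f j x) Set.univ = m j := by
      intro j hj
      rw [withDensity_apply _ MeasurableSet.univ, setLIntegral_univ, lintegral_const_mul _ (hf j)]
      by_cases h0 : ∫⁻ x, f j x ∂ρ = 0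
      · rw [h0, mul_zero]
        exact (le_antisymm (h0 ▸ hmρ j) zero_le).symm
      · exact ENNReal.div_mul_cancel h0 (hfin j hj)
    refine ⟨_, fun j => ρ.withDensity fun x => α j * f j x, hdec, ?_, hmass, ?_, ?_⟩
    · refine isFiniteMeasure_withDensity (ne_top_of_le_ne_top ENNReal.one_ne_top
        ((lintegral_mono fun x => tsub_le_self).trans (by simp)))
    · intro j hj
      rw [← hmass j hj, withDensity_apply _ MeasurableSet.univ, setLIntegral_univ,
        lintegral_withDensity_eq_lintegral_mul _ (hαf j) (hmc _), ← lintegral_const_mul _ (hαf j)]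
      refine lintegral_mono fun x => ?_
      simp only [Pi.mul_apply]
      by_cases h0 : f j x = 0
      · simp [h0]
      · rw [mul_comm]
        gcongr
        · exact hd.nonneg _ _
        · exact hc j x h0
    · have hsum : ∫⁻ x, ENNReal.ofReal (d x a ^ p) ∂ρ =
          ∫⁻ x, ENNReal.ofReal (d x a ^ p)
            ∂(ρ.withDensity (fun x => 1 - ∑ j ∈ Finset.range k, α j * f j x)) +
          ∑ j ∈ Finset.range k, α j * ∫⁻ x, f j x * ENNReal.ofReal (d x a ^ p) ∂ρ := by
        conv_lhs => rw [hdec]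
        rw [lintegral_add_measure, lintegral_finsetSum_measure]
        congr 1
        refine Finset.sum_congr rfl fun j _ => ?_
        rw [lintegral_withDensity_eq_lintegral_mul _ (hαf j) (hmc _),
          ← lintegral_const_mul' _ _ (ne_top_of_le_ne_top ENNReal.one_ne_top (hα1 j))]
        simp only [Pi.mul_apply, mul_assoc]
      refine ENNReal.eq_sub_of_add_eq ?_ hsum.symm
      exact ne_top_of_le_ne_top hρ (hsum ▸ le_add_self)
  obtain ⟨res, part, hμ_eq, _, hmass, hdiag, hres⟩ := side μ ‹_› hμ fun j => min_le_left _ _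
  obtain ⟨res', part', hν_eq, _, hmass', hdiag', hres'⟩ := side ν ‹_› hν fun j => min_le_right _ _
  have hm1 : ∑ j ∈ Finset.range k, m j ≤ 1 := by
    calc ∑ j ∈ Finset.range k, m j ≤ ∑ j ∈ Finset.range k, ∫⁻ x, f j x ∂μ :=
          Finset.sum_le_sum fun j _ => min_le_left _ _
      _ = ∫⁻ x, ∑ j ∈ Finset.range k, f j x ∂μ := (lintegral_finsetSum _ fun j _ => hf j).symm
      _ ≤ ∫⁻ _, 1 ∂μ := lintegral_mono hf1
      _ = 1 := by simp
  have huniv : res Set.univ = res' Set.univ := by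
    have h1 : res Set.univ + ∑ j ∈ Finset.range k, m j = 1 := by
      rw [← Finset.sum_congr rfl hmass, ← Measure.finsetSum_apply, ← Measure.add_apply, ← hμ_eq,
        measure_univ]
    have h2 : res' Set.univ + ∑ j ∈ Finset.range k, m j = 1 := by
      rw [← Finset.sum_congr rfl hmass', ← Measure.finsetSum_apply, ← Measure.add_apply, ← hν_eq,
        measure_univ]
    exact (ENNReal.add_left_inj (ne_top_of_le_ne_top ENNReal.one_ne_top hm1)).1 (h1.trans h2.symm)
  have hparts : ∀ j ∈ Finset.range k, transportCost d p (part j) (part' j) ≤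
      2 ^ (p - 1) * (2 * ENNReal.ofReal (r ^ p)) * m j := by
    intro j hj
    have hmt : m j ≠ ∞ := ne_top_of_le_ne_top ENNReal.one_ne_top
      ((Finset.single_le_sum (f := m) (fun _ _ => zero_le) hj).trans hm1)
    have : IsFiniteMeasure (part j) := ⟨by rw [hmass j hj]; exact hmt.lt_top⟩
    have : IsFiniteMeasure (part' j) := ⟨by rw [hmass' j hj]; exact hmt.lt_top⟩
    refine (transportCost_le_of_measure_univ_eq hd hm hp
      ((hmass j hj).trans (hmass' j hj).symm) (c j)).trans ?_
    rw [mul_assoc, mul_assoc, two_mul]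
    gcongr
    · exact hdiag j hj
    · exact hdiag' j hj
  rw [← hres, ← hres']
  calc transportCost d p μ ν
      = transportCost d p (res + ∑ j ∈ Finset.range k, part j)
          (res' + ∑ j ∈ Finset.range k, part' j) := by rw [← hμ_eq, ← hν_eq]
    _ ≤ transportCost d p res res' +
          ∑ j ∈ Finset.range k, transportCost d p (part j) (part' j) :=
        (transportCost_add_le _ _ _ _).trans (by gcongr; exact transportCost_sum_le _ _ _)
    _ ≤ 2 ^ (p - 1) * (∫⁻ x, ENNReal.ofReal (d x a ^ p) ∂res +
          ∫⁻ x, ENNReal.ofReal (d x a ^ p) ∂res') +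
          ∑ j ∈ Finset.range k, 2 ^ (p - 1) * (2 * ENNReal.ofReal (r ^ p)) * m j :=
        add_le_add (transportCost_le_of_measure_univ_eq hd hm hp huniv a)
          (Finset.sum_le_sum hparts)
    _ ≤ 2 ^ (p - 1) * (∫⁻ x, ENNReal.ofReal (d x a ^ p) ∂res +
          ∫⁻ x, ENNReal.ofReal (d x a ^ p) ∂res') +
          2 ^ (p - 1) * (2 * ENNReal.ofReal (r ^ p)) := by
        rw [← Finset.mul_sum]
        exact add_le_add le_rfl (mul_le_of_le_one_right' hm1)
    _ = _ := by ring

end Localization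

/-! ### A continuous partition of unity with small supports -/

section PartitionOfUnity

open scoped BoundedContinuousFunction

variable {Z : Type*} [TopologicalSpace Z] {d : Z → Z → ℝ}

/-- A countable continuous partition of unity subordinate to the `d`-balls of radius `r`. Only the
continuity of `d` is used, so `d` need not induce the topology. -/
theorem exists_partition_of_unity [TopologicalSpace.SeparableSpace Z] [Nonempty Z]
    (hd : IsMetricOn d)
    (hdc : Continuous fun w : Z × Z => d w.1 w.2) {r : ℝ} (hr : 0 < r) :
    ∃ (φ : ℕ → Z →ᵇ ℝ≥0) (c : ℕ → Z), (∀ j x, φ j x ≠ 0 → d x (c j) ≤ r) ∧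
      ∀ x, ∑' j, (φ j x : ℝ≥0∞) = 1 := by
  obtain ⟨c, hc⟩ := TopologicalSpace.exists_dense_seq Z
  have hcont : ∀ a, Continuous fun x => d x a := fun a => hdc.comp (Continuous.prodMk_left a)
  -- `ψ j` is `1` on the ball of radius `r / 2` about `c j` and `0` off the ball of radius `r`; the
  -- partition of unity consists of the increments of the running maxima `M k` of the `ψ j`.
  set ψ : ℕ → Z → ℝ≥0 := fun j x => (min 1 (2 * (r - d x (c j)) / r)).toNNReal with hψ
  have hψc : ∀ j, Continuous (ψ j) := fun j => by
    have := hcont (c j)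
    fun_prop
  set M : ℕ → Z → ℝ≥0 := fun k x => (Finset.range k).sup fun j => ψ j x with hM
  have hMc : ∀ k, Continuous (M k) := fun k =>
    Continuous.finset_sup_apply fun j _ => hψc j
  have hM1 : ∀ k x, M k x ≤ 1 := fun k x => Finset.sup_le fun j _ => by
    simp [hψ]
  have hMs : ∀ k x, M (k + 1) x = max (ψ k x) (M k x) := fun k x => by
    simp only [hM, Finset.range_add_one, Finset.sup_insert]
  have hMmono : ∀ k x, M k x ≤ M (k + 1) x := fun k x => (hMs k x).symm ▸ le_max_right _ _
  have hle : ∀ k x, M (k + 1) x - M k x ≤ 1 := fun k x => tsub_le_self.trans (hM1 _ _)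
  refine ⟨fun k => BoundedContinuousFunction.mkOfBound
    ⟨fun x => M (k + 1) x - M k x, (hMc _).sub (hMc _)⟩ 1 fun x y => ?_, c, fun j x hj => ?_,
    fun x => ?_⟩
  · rw [NNReal.dist_eq, abs_sub_le_iff]
    have hx : ((M (k + 1) x - M k x : ℝ≥0) : ℝ) ≤ 1 := by exact_mod_cast hle k x
    have hy : ((M (k + 1) y - M k y : ℝ≥0) : ℝ) ≤ 1 := by exact_mod_cast hle k y
    have hx0 := (M (k + 1) x - M k x).coe_nonneg
    have hy0 := (M (k + 1) y - M k y).coe_nonneg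
    constructor <;> simp only [ContinuousMap.coe_mk] <;> linarith
  · by_contra! hlt
    refine hj ?_
    have h0 : ψ j x = 0 := by
      refine Real.toNNReal_of_nonpos (min_le_of_right_le ?_)
      exact div_nonpos_of_nonpos_of_nonneg (by linarith) hr.le
    simp [hMs, h0]
  · refine tendsto_nhds_unique (ENNReal.tendsto_nat_tsum _) ?_
    have hpart : ∀ k, ∑ j ∈ Finset.range k, ((M (j + 1) x - M j x : ℝ≥0) : ℝ≥0∞) = M k x := by
      intro k
      induction k with
      | zero => simp [hM]
      | succ k ih =>
        rw [Finset.sum_range_succ, ih, ← ENNReal.coe_add, add_tsub_cancel_of_le (hMmono k x)]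
    refine Tendsto.congr (fun k => (hpart k).symm) ?_
    obtain ⟨j, hj⟩ := hc.exists_mem_open (s := {y | d y x < r / 2})
      (isOpen_lt (hcont x) continuous_const)
      ⟨x, by simpa [(hd.eq_zero_iff x x).2 rfl] using hr⟩
    refine tendsto_const_nhds.congr' ?_
    filter_upwards [eventually_ge_atTop (j + 1)] with k hk
    have h1 : ψ j x = 1 := by
      have : (1 : ℝ) ≤ 2 * (r - d x (c j)) / r := by
        rw [le_div_iff₀ hr]
        have : d (c j) x < r / 2 := hj
        rw [hd.symm] at this
        linarith
      simp [hψ, min_eq_left this]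
    have h2 : M k x = 1 := le_antisymm (hM1 k x)
      (h1 ▸ Finset.le_sup (f := fun j => ψ j x) (Finset.mem_range.2 hk))
    rw [h2, ENNReal.coe_one]

end PartitionOfUnity

/-! ### Weak convergence with moments implies convergence in transport cost -/

section Limits

open scoped BoundedContinuousFunction

/-- The scaling factors `min (A i) B / A' i` tend to `1` only if `B ≠ 0`; if `B = 0` they stay
at most `1` while `X i` tends to `0`. -/
theorem tendsto_min_div_mul {ι : Type*} {l : Filter ι} {A X A' : ι → ℝ≥0∞} {B Y : ℝ≥0∞}
    (hB : B ≠ ∞) (hY : Y ≠ ∞) (hA : Tendsto A l (𝓝 B)) (hA' : Tendsto A' l (𝓝 B))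
    (hX : Tendsto X l (𝓝 Y))
    (hBY : B = 0 → Y = 0) (hle : ∀ i, min (A i) B ≤ A' i) :
    Tendsto (fun i => min (A i) B / A' i * X i) l (𝓝 Y) := by
  by_cases h0 : B = 0
  · have hY0 := hBY h0
    subst hY0
    refine tendsto_of_tendsto_of_tendsto_of_le_of_le tendsto_const_nhds hX (fun _ => zero_le)
      fun i => mul_le_of_le_one_left' (ENNReal.div_le_of_le_mul (by simpa using hle i))
  · have hmin : Tendsto (fun i => min (A i) B) l (𝓝 B) := by
      simpa using hA.min (tendsto_const_nhds (x := B))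
    have hdiv : Tendsto (fun i => min (A i) B / A' i) l (𝓝 1) := by
      simpa [ENNReal.div_self h0 hB] using ENNReal.Tendsto.div hmin (Or.inl h0) hA' (Or.inl hB)
    simpa using ENNReal.Tendsto.mul hdiv (Or.inr hY) hX (Or.inr ENNReal.one_ne_top)

variable {Z : Type*} [TopologicalSpace Z] [TopologicalSpace.SeparableSpace Z] [MeasurableSpace Z]
  [BorelSpace Z] {d : Z → Z → ℝ} {p : ℝ}

/-- Weak convergence together with convergence of the `p`-th moments to a finite limit implies
convergence in transport cost. -/
theorem tendsto_transportCost_zero (hd : IsMetricOn d)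
    (hdc : Continuous fun w : Z × Z => d w.1 w.2) (hm : Measurable fun w : Z × Z => d w.1 w.2)
    (hp : 1 ≤ p) {ι : Type*} {l : Filter ι}
    {μ : ι → Measure Z} {ν : Measure Z} [∀ i, IsProbabilityMeasure (μ i)] [IsProbabilityMeasure ν]
    (a : Z) (hweak : ∀ f : Z →ᵇ ℝ≥0, Tendsto (fun i => ∫⁻ x, f x ∂μ i) l (𝓝 (∫⁻ x, f x ∂ν)))
    (hmom : Tendsto (fun i => ∫⁻ x, ENNReal.ofReal (d x a ^ p) ∂μ i) l
      (𝓝 (∫⁻ x, ENNReal.ofReal (d x a ^ p) ∂ν)))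
    (hfin : ∫⁻ x, ENNReal.ofReal (d x a ^ p) ∂ν ≠ ∞) :
    Tendsto (fun i => transportCost d p (μ i) ν) l (𝓝 0) := by
  have hp0 : 0 < p := by linarith
  have : Nonempty Z := ⟨a⟩
  have hC : (2 : ℝ≥0∞) ^ (p - 1) ≠ ∞ := ENNReal.rpow_ne_top_of_nonneg (by linarith) (by simp)
  have hga : Continuous fun x => d x a ^ p :=
    (hdc.comp (Continuous.prodMk_left a)).rpow_const fun _ => Or.inr hp0.le
  set G := ∫⁻ x, ENNReal.ofReal (d x a ^ p) ∂ν with hG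
  refine tendsto_order.2 ⟨fun b hb => absurd hb not_lt_zero, fun δ hδ => ?_⟩
  obtain ⟨r, hr, hrδ⟩ : ∃ r : ℝ, 0 < r ∧ 2 ^ (p - 1) * (2 * ENNReal.ofReal (r ^ p)) < δ := by
    have h : Tendsto (fun r : ℝ => (2 : ℝ≥0∞) ^ (p - 1) * (2 * ENNReal.ofReal (r ^ p)))
        (𝓝 0) (𝓝 0) := by
      have h1 : Tendsto (fun r : ℝ => ENNReal.ofReal (r ^ p)) (𝓝 0) (𝓝 0) := by
        have := ENNReal.tendsto_ofReal ((Real.continuousAt_rpow_const 0 p (Or.inr hp0.le)).tendsto)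
        simpa [Real.zero_rpow hp0.ne'] using this
      have h2 := ENNReal.Tendsto.const_mul (ENNReal.Tendsto.const_mul h1
        (Or.inr (ENNReal.ofNat_ne_top (n := 2)))) (Or.inr hC)
      simpa using h2
    obtain ⟨r, h1, h2⟩ := (((h.mono_left nhdsWithin_le_nhds).eventually
      (gt_mem_nhds hδ)).and (self_mem_nhdsWithin (s := Set.Ioi (0 : ℝ)))).exists
    exact ⟨r, h2, h1⟩
  obtain ⟨φ, c, hφc, hφ1⟩ := exists_partition_of_unity hd hdc hr
  have hφm : ∀ j, Measurable fun x => (φ j x : ℝ≥0∞) := fun j =>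
    (φ j).continuous.measurable.coe_nnreal_ennreal
  have hgm : Measurable fun x => ENNReal.ofReal (d x a ^ p) := hga.measurable.ennreal_ofReal
  have hφgm : ∀ j, Measurable fun x => φ j x * ENNReal.ofReal (d x a ^ p) := fun j =>
    (hφm j).mul hgm
  -- The products `φ j * d(·, a) ^ p` are bounded, as `φ j` is supported in a ball, so weak
  -- convergence applies to them although `d(·, a) ^ p` itself is unbounded.
  have hprod : ∀ j, ∃ f : Z →ᵇ ℝ≥0,
      ∀ x, (f x : ℝ≥0∞) = φ j x * ENNReal.ofReal (d x a ^ p) := by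
    intro j
    have hle1 : ∀ x, φ j x ≤ 1 := fun x => by
      have := (ENNReal.le_tsum (f := fun j => (φ j x : ℝ≥0∞)) j).trans_eq (hφ1 x)
      exact_mod_cast this
    have hb : ∀ x, φ j x * (d x a ^ p).toNNReal ≤ ((r + d (c j) a) ^ p).toNNReal := fun x => by
      by_cases h0 : φ j x = 0
      · simp [h0]
      · refine (mul_le_of_le_one_left' (hle1 x)).trans (Real.toNNReal_le_toNNReal ?_)
        refine Real.rpow_le_rpow (hd.nonneg _ _) ?_ hp0.le
        exact (hd.triangle x (c j) a).trans (by linarith [hφc j x h0])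
    refine ⟨BoundedContinuousFunction.mkOfBound
      ⟨fun x => φ j x * (d x a ^ p).toNNReal, (φ j).continuous.mul
        (continuous_real_toNNReal.comp hga)⟩ ((r + d (c j) a) ^ p).toNNReal fun x y => ?_,
      fun x => by simp [ENNReal.ofReal]⟩
    rw [NNReal.dist_eq, abs_sub_le_iff]
    have hx := NNReal.coe_le_coe.2 (hb x)
    have hy := NNReal.coe_le_coe.2 (hb y)
    have hx0 := (φ j x * (d x a ^ p).toNNReal).coe_nonneg
    have hy0 := (φ j y * (d y a ^ p).toNNReal).coe_nonneg
    constructor <;> simp only [ContinuousMap.coe_mk] <;> linarith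
  have hφg : ∀ j, Tendsto (fun i => ∫⁻ x, φ j x * ENNReal.ofReal (d x a ^ p) ∂μ i) l
      (𝓝 (∫⁻ x, φ j x * ENNReal.ofReal (d x a ^ p) ∂ν)) := fun j => by
    obtain ⟨f, hf⟩ := hprod j
    simpa only [hf] using hweak f
  have hsum : ∑' j, ∫⁻ x, φ j x * ENNReal.ofReal (d x a ^ p) ∂ν = G := by
    rw [← lintegral_tsum fun j => (hφgm j).aemeasurable]
    simp only [ENNReal.tsum_mul_right, hφ1, one_mul, hG]
  have hYfin : ∀ j, ∫⁻ x, φ j x * ENNReal.ofReal (d x a ^ p) ∂ν ≠ ∞ := fun j =>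
    ne_top_of_le_ne_top hfin (hsum ▸ ENNReal.le_tsum j)
  have hBfin : ∀ j, ∫⁻ x, φ j x ∂ν ≠ ∞ := fun j => by
    refine ne_top_of_le_ne_top ENNReal.one_ne_top (?_ : _ ≤ (1 : ℝ≥0∞))
    refine (lintegral_mono fun x => (ENNReal.le_tsum (f := fun j => (φ j x : ℝ≥0∞)) j).trans_eq
      (hφ1 x)).trans (by simp)
  have hBY : ∀ j, ∫⁻ x, φ j x ∂ν = 0 → ∫⁻ x, φ j x * ENNReal.ofReal (d x a ^ p) ∂ν = 0 := by
    intro j h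
    rw [lintegral_eq_zero_iff (hφm j)] at h
    rw [lintegral_eq_zero_iff (hφgm j)]
    filter_upwards [h] with x hx
    simp only [Pi.zero_apply] at hx ⊢
    rw [hx, zero_mul]
  -- For large `k` the first `k` functions nearly exhaust the moment of `ν`.
  obtain ⟨k, hk⟩ : ∃ k, 2 ^ (p - 1) * (2 * ENNReal.ofReal (r ^ p) +
      (G - ∑ j ∈ Finset.range k, ∫⁻ x, φ j x * ENNReal.ofReal (d x a ^ p) ∂ν) +
      (G - ∑ j ∈ Finset.range k, ∫⁻ x, φ j x * ENNReal.ofReal (d x a ^ p) ∂ν)) < δ := by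
    have h1 := ENNReal.tendsto_nat_tsum fun j => ∫⁻ x, φ j x * ENNReal.ofReal (d x a ^ p) ∂ν
    rw [hsum] at h1
    have h2 := ENNReal.Tendsto.sub (tendsto_const_nhds (x := G)) h1 (Or.inl hfin)
    have h3 := ENNReal.Tendsto.const_mul (((tendsto_const_nhds
      (x := 2 * ENNReal.ofReal (r ^ p))).add h2).add h2) (Or.inr hC)
    rw [tsub_self, add_zero, add_zero] at h3
    exact (h3.eventually (gt_mem_nhds hrδ)).exists
  have hlim := ENNReal.Tendsto.const_mul (((tendsto_const_nhds (f := l)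
    (x := 2 * ENNReal.ofReal (r ^ p))).add
    (ENNReal.Tendsto.sub hmom (tendsto_finsetSum (Finset.range k) fun j _ =>
      tendsto_min_div_mul (hBfin j) (hYfin j) (hweak (φ j)) (hweak (φ j)) (hφg j) (hBY j)
        fun i => min_le_left _ _) (Or.inl hfin))).add
    (ENNReal.Tendsto.sub (tendsto_const_nhds (x := G))
      (tendsto_finsetSum (Finset.range k) fun j _ =>
      tendsto_min_div_mul (hBfin j) (hYfin j) (hweak (φ j)) tendsto_const_nhds
        tendsto_const_nhds (hBY j)
        fun i => min_le_right _ _) (Or.inl hfin))) (Or.inr hC)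
  filter_upwards [hlim.eventually (gt_mem_nhds hk),
    hmom.eventually (gt_mem_nhds hfin.lt_top)] with i hi hifin
  refine lt_of_le_of_lt ?_ hi
  refine transportCost_le_of_partition hd hm hp a hifin.ne hfin k hφm (fun x => ?_) c
    fun j x hj => hφc j x fun h => hj (by simp [h])
  exact (ENNReal.sum_le_tsum _).trans_eq (hφ1 x)

end Limits

/-! ### The Wasserstein distance -/

section Triangle

open scoped ProbabilityTheory

variable {Z : Type*} [MeasurableSpace Z] {d : Z → Z → ℝ} {p : ℝ}

theorem wassersteinDist_eq_iInf (hp : 1 ≤ p) (μ ν : Measure Z) : wassersteinDist d p μ ν =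
    ⨅ (π : Measure (Z × Z)) (_ : IsCoupling π μ ν),
      (∫⁻ w, ENNReal.ofReal (d w.1 w.2 ^ p) ∂π) ^ (1 / p) :=
  (ENNReal.orderIsoRpow (1 / p) (by positivity)).map_iInf₂ _

/-- Gluing: two couplings with a common middle marginal come from one measure on the triple product,
obtained by attaching the conditional kernel of the second coupling to the first. -/
theorem exists_glue [StandardBorelSpace Z] [Nonempty Z] {μ ν ρ : Measure Z} [IsFiniteMeasure μ]
    [IsFiniteMeasure ν] {π π' : Measure (Z × Z)} (h : IsCoupling π μ ν) (h' : IsCoupling π' ν ρ) :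
    ∃ Θ : Measure ((Z × Z) × Z), Θ.map Prod.fst = π ∧ Θ.map (fun w => (w.1.2, w.2)) = π' := by
  have : IsFiniteMeasure π := ⟨by
    rw [← Set.preimage_univ (f := Prod.fst), ← Measure.map_apply measurable_fst .univ, h.fst]
    exact measure_lt_top _ _⟩
  have : IsFiniteMeasure π' := ⟨by
    rw [← Set.preimage_univ (f := Prod.fst), ← Measure.map_apply measurable_fst .univ, h'.fst]
    exact measure_lt_top _ _⟩
  refine ⟨π ⊗ₘ π'.condKernel.comap Prod.snd measurable_snd, Measure.fst_compProd _ _, ?_⟩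
  conv_rhs => rw [← π'.disintegrate π'.condKernel, Measure.fst, h'.fst, ← h.snd]
  refine Measure.ext_of_lintegral _ fun f hf => ?_
  rw [lintegral_map hf (by fun_prop), Measure.lintegral_compProd (by fun_prop),
    Measure.lintegral_compProd hf, lintegral_map (by fun_prop) measurable_snd]
  simp

theorem wassersteinDist_triangle [StandardBorelSpace Z] [Nonempty Z] (hd : IsMetricOn d)
    (hm : Measurable fun w : Z × Z => d w.1 w.2) (hp : 1 ≤ p) (μ ν ρ : Measure Z)
    [IsFiniteMeasure μ] [IsFiniteMeasure ν] :
    wassersteinDist d p μ ρ ≤ wassersteinDist d p μ ν + wassersteinDist d p ν ρ := by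
  have hp0 : 0 ≤ p := by linarith
  simp only [wassersteinDist_eq_iInf hp μ ν, wassersteinDist_eq_iInf hp ν ρ, ENNReal.iInf_add,
    ENNReal.add_iInf]
  refine le_iInf₂ fun π' hπ' => le_iInf₂ fun π hπ => ?_
  obtain ⟨Θ, h1, h2⟩ := exists_glue hπ hπ'
  have h13 : IsCoupling (Θ.map fun w => (w.1.1, w.2)) μ ρ := by
    constructor
    · rw [Measure.map_map measurable_fst (by fun_prop), ← hπ.fst, ← h1,
        Measure.map_map measurable_fst measurable_fst]
      rfl
    · rw [Measure.map_map measurable_snd (by fun_prop), ← hπ'.snd, ← h2,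
        Measure.map_map measurable_snd (by fun_prop)]
      rfl
  rw [wassersteinDist_eq_iInf hp]
  refine (iInf₂_le (Θ.map fun w => (w.1.1, w.2)) h13).trans ?_
  rw [← h1, ← h2, lintegral_map (by fun_prop) (by fun_prop),
    lintegral_map (by fun_prop) (by fun_prop), lintegral_map (by fun_prop) (by fun_prop)]
  simp only [← ENNReal.ofReal_rpow_of_nonneg (hd.nonneg _ _) hp0]
  have hm12 : Measurable fun w : (Z × Z) × Z => ENNReal.ofReal (d w.1.1 w.1.2) :=
    (hm.comp measurable_fst).ennreal_ofReal
  have hm23 : Measurable fun w : (Z × Z) × Z => ENNReal.ofReal (d w.1.2 w.2) :=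
    (hm.comp (by fun_prop : Measurable fun w : (Z × Z) × Z => (w.1.2, w.2))).ennreal_ofReal
  refine le_trans ?_ (ENNReal.lintegral_Lp_add_le hm12.aemeasurable hm23.aemeasurable hp)
  gcongr with w
  rw [Pi.add_apply, ← ENNReal.ofReal_add (hd.nonneg _ _) (hd.nonneg _ _)]
  exact ENNReal.ofReal_le_ofReal (hd.triangle _ _ _)

end Triangle

theorem wassersteinDist_comm {Z : Type*} [MeasurableSpace Z] {d : Z → Z → ℝ} {p : ℝ}
    (hd : IsMetricOn d) (hm : Measurable fun w : Z × Z => d w.1 w.2) (μ ν : Measure Z) :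
    wassersteinDist d p μ ν = wassersteinDist d p ν μ :=
  congrArg (· ^ (1 / p)) (transportCost_comm hd hm μ ν)

/-- Continuity of the Wasserstein distance in both arguments. Truncated subtraction in `ℝ≥0∞` makes
the lower bound valid without finiteness assumptions. -/
theorem tendsto_wassersteinDist {Z : Type*} [MeasurableSpace Z] [StandardBorelSpace Z] [Nonempty Z]
    {d : Z → Z → ℝ} {p : ℝ} (hd : IsMetricOn d) (hm : Measurable fun w : Z × Z => d w.1 w.2)
    (hp : 1 ≤ p) {ι : Type*} {l : Filter ι} {μ μ' : ι → Measure Z} {ν ν' : Measure Z}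
    [∀ i, IsFiniteMeasure (μ i)] [∀ i, IsFiniteMeasure (μ' i)] [IsFiniteMeasure ν]
    [IsFiniteMeasure ν']
    (h : Tendsto (fun i => wassersteinDist d p (μ i) ν) l (𝓝 0))
    (h' : Tendsto (fun i => wassersteinDist d p (μ' i) ν') l (𝓝 0)) :
    Tendsto (fun i => wassersteinDist d p (μ i) (μ' i)) l (𝓝 (wassersteinDist d p ν ν')) := by
  have htri := fun (μ ν ρ : Measure Z) [IsFiniteMeasure μ] [IsFiniteMeasure ν] =>
    wassersteinDist_triangle (p := p) hd hm hp μ ν ρ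
  have hlow : Tendsto (fun i => wassersteinDist d p ν ν' -
      (wassersteinDist d p (μ i) ν + wassersteinDist d p (μ' i) ν')) l
      (𝓝 (wassersteinDist d p ν ν')) := by
    simpa using ENNReal.Tendsto.sub (tendsto_const_nhds (x := wassersteinDist d p ν ν'))
      (h.add h') (Or.inr (by simp))
  have hup : Tendsto (fun i => wassersteinDist d p (μ i) ν + wassersteinDist d p ν ν' +
      wassersteinDist d p (μ' i) ν') l (𝓝 (wassersteinDist d p ν ν')) := by
    simpa using (h.add_const (wassersteinDist d p ν ν')).add h'
  refine tendsto_of_tendsto_of_tendsto_of_le_of_le hlow hup (fun i => ?_) fun i => ?_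
  · refine tsub_le_iff_left.2 ?_
    calc wassersteinDist d p ν ν'
        ≤ wassersteinDist d p ν (μ i) + (wassersteinDist d p (μ i) (μ' i) +
            wassersteinDist d p (μ' i) ν') :=
          (htri ν (μ i) ν').trans (add_le_add le_rfl (htri (μ i) (μ' i) ν'))
      _ = _ := by rw [wassersteinDist_comm hd hm ν]; ring
  · calc wassersteinDist d p (μ i) (μ' i)
        ≤ wassersteinDist d p (μ i) ν + (wassersteinDist d p ν ν' +
            wassersteinDist d p ν' (μ' i)) :=
          (htri (μ i) ν (μ' i)).trans (add_le_add le_rfl (htri ν ν' (μ' i)))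
      _ = _ := by rw [wassersteinDist_comm hd hm ν']; ring

theorem wassersteinDist_lt_top {Z : Type*} [MeasurableSpace Z]
    {d : Z → Z → ℝ} {p : ℝ} (hd : IsMetricOn d) (hm : Measurable fun w : Z × Z => d w.1 w.2)
    (hp : 1 ≤ p) {μ ν : Measure Z} [IsProbabilityMeasure μ] [IsProbabilityMeasure ν] (a : Z)
    (hμ : ∫⁻ x, ENNReal.ofReal (d x a ^ p) ∂μ < ∞) (hν : ∫⁻ x, ENNReal.ofReal (d x a ^ p) ∂ν < ∞) :
    wassersteinDist d p μ ν < ∞ := by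
  refine ENNReal.rpow_lt_top_of_nonneg (by positivity) (ne_of_lt ?_)
  refine (transportCost_le_of_measure_univ_eq hd hm hp (by simp) a).trans_lt ?_
  exact ENNReal.mul_lt_top (ENNReal.rpow_lt_top_of_nonneg (by linarith) (by simp))
    (ENNReal.add_lt_top.2 ⟨hμ, hν⟩)

/-! ### Pooled measures in the limit of infinite width -/

theorem tendsto_wassersteinDist_pooledMeasure {Z : Type*} [TopologicalSpace Z] [PolishSpace Z]
    [MeasurableSpace Z] [BorelSpace Z] {d : Z → Z → ℝ} {p : ℝ} (hd : IsMetricOn d)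
    (hdc : Continuous fun w : Z × Z => d w.1 w.2) (hp : 1 ≤ p) {ι : Type*} {l : Filter ι}
    (q : ι → PMF ℤ) (hmono : ∀ i (k k' : ℤ), |k| ≤ |k'| → q i k' ≤ q i k)
    (hunif : ∀ k, Tendsto (fun i => q i k) l (𝓝 0)) (z : ℤ → Z) (a : Z) (F : ProbabilityMeasure Z)
    (hF : Tendsto (fun N : ℕ => empiricalDist z N) atTop (𝓝 F))
    (hmom : Tendsto
      (fun N : ℕ => ∫⁻ x, ENNReal.ofReal (d x a ^ p) ∂(empiricalDist z N : Measure Z)) atTop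
      (𝓝 (∫⁻ x, ENNReal.ofReal (d x a ^ p) ∂(F : Measure Z))))
    (hfin : ∫⁻ x, ENNReal.ofReal (d x a ^ p) ∂(F : Measure Z) < ⊤) :
    Tendsto (fun i => wassersteinDist d p (pooledMeasure (q i) z 0) F) l (𝓝 0) := by
  have hp0 : 0 < p := by linarith
  have hga : Continuous fun x => d x a ^ p :=
    (hdc.comp (Continuous.prodMk_left a)).rpow_const fun _ => Or.inr hp0.le
  have := fun i => isProbabilityMeasure_pooledMeasure (q i) z 0
  have h := tendsto_transportCost_zero hd hdc hdc.measurable hp a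
    (fun f => tendsto_lintegral_pooledMeasure q hmono hunif z
      f.continuous.measurable.coe_nnreal_ennreal (fun _ => ENNReal.coe_ne_top)
      (ProbabilityMeasure.tendsto_iff_forall_lintegral_tendsto.1 hF f))
    (tendsto_lintegral_pooledMeasure q hmono hunif z hga.measurable.ennreal_ofReal
      (fun _ => ENNReal.ofReal_ne_top) hmom) hfin.ne
  have h1 := ((ENNReal.continuous_rpow_const (y := 1 / p)).tendsto 0).comp h
  rwa [ENNReal.zero_rpow_of_pos (by positivity)] at h1

theorem theorem2
    {Z : Type*} [TopologicalSpace Z] [PolishSpace Z] [MeasurableSpace Z] [BorelSpace Z]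
    -- the cost function, a metric that is continuous for the topology of weak convergence
    (d : Z → Z → ℝ) (hd : IsMetricOn d) (hdc : Continuous fun w : Z × Z => d w.1 w.2)
    (p : ℝ) (hp : 1 ≤ p)
    -- the pooling PMFs
    (q : ℝ≥0 → PMF ℤ)
    (hsymm : ∀ (σ : ℝ≥0) (k : ℤ), q σ k = q σ (-k))
    (hmono : ∀ (σ : ℝ≥0) (k k' : ℤ), |k| ≤ |k'| → q σ k' ≤ q σ k)
    (hunif : ∀ k : ℤ, Tendsto (fun σ : ℝ≥0 => q σ k) atTop (𝓝 0))
    -- the two feature sequences, the reference point and the limit distributions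
    (z z' : ℤ → Z) (z₀ : Z) (F F' : ProbabilityMeasure Z)
    (hF : Tendsto (fun N : ℕ => empiricalDist z N) atTop (𝓝 F))
    (hF' : Tendsto (fun N : ℕ => empiricalDist z' N) atTop (𝓝 F'))
    (hmom : Tendsto
      (fun N : ℕ => ∫⁻ x, ENNReal.ofReal (d x z₀ ^ p) ∂(empiricalDist z N : Measure Z)) atTop
      (𝓝 (∫⁻ x, ENNReal.ofReal (d x z₀ ^ p) ∂(F : Measure Z))))
    (hfin : ∫⁻ x, ENNReal.ofReal (d x z₀ ^ p) ∂(F : Measure Z) < ⊤)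
    (hmom' : Tendsto
      (fun N : ℕ => ∫⁻ x, ENNReal.ofReal (d x z₀ ^ p) ∂(empiricalDist z' N : Measure Z)) atTop
      (𝓝 (∫⁻ x, ENNReal.ofReal (d x z₀ ^ p) ∂(F' : Measure Z))))
    (hfin' : ∫⁻ x, ENNReal.ofReal (d x z₀ ^ p) ∂(F' : Measure Z) < ⊤)
    (hsum : ∀ σ : ℝ≥0, ∑' k : ℤ, q σ k * ENNReal.ofReal (d (z k) z₀ ^ p) < ⊤)
    (hsum' : ∀ σ : ℝ≥0, ∑' k : ℤ, q σ k * ENNReal.ofReal (d (z' k) z₀ ^ p) < ⊤) :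
    (∀ σ : ℝ≥0, distortionAt d p (q σ) z z' 0 < ⊤) ∧
      wassersteinDist d p (F : Measure Z) (F' : Measure Z) < ⊤ ∧
      Tendsto (fun σ : ℝ≥0 => distortionAt d p (q σ) z z' 0) atTop
        (𝓝 (wassersteinDist d p (F : Measure Z) (F' : Measure Z) ^ p)) := by
  have : Nonempty Z := ⟨z₀⟩
  have hp0 : 0 ≤ p := by linarith
  have hm := hdc.measurable
  have hg : Measurable fun x => ENNReal.ofReal (d x z₀ ^ p) :=
    ((hdc.comp (Continuous.prodMk_left z₀)).rpow_const
      fun _ => Or.inr hp0).measurable.ennreal_ofReal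
  have hP := fun σ => isProbabilityMeasure_pooledMeasure (q σ) z 0
  have hP' := fun σ => isProbabilityMeasure_pooledMeasure (q σ) z' 0
  refine ⟨fun σ => ?_, wassersteinDist_lt_top hd hm hp z₀ hfin hfin', ?_⟩
  · refine ENNReal.rpow_lt_top_of_nonneg hp0 (wassersteinDist_lt_top hd hm hp z₀ ?_ ?_).ne
    · rw [lintegral_pooledMeasure_zero _ _ hg]
      exact hsum σ
    · rw [lintegral_pooledMeasure_zero _ _ hg]
      exact hsum' σ
  · have h := tendsto_wassersteinDist_pooledMeasure hd hdc hp q hmono hunif z z₀ F hF hmom hfin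
    have h' :=
      tendsto_wassersteinDist_pooledMeasure hd hdc hp q hmono hunif z' z₀ F' hF' hmom' hfin'
    exact ((ENNReal.continuous_rpow_const (y := p)).tendsto _).comp
      (tendsto_wassersteinDist hd hm hp h h')
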